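/- Let $n \ge 0$ and $p \ge 1$ be integers, $A \in \mathbb{R}^{n\times n}$, $B \in \mathbb{R}^{n\times p}$, $C \in \mathbb{R}^{p\times n}$, $\lambda \in \mathbb{R}$, and let $\|\cdot\|$ be the Frobenius norm. Put $\widetilde A = A - \lambda BC$, and write $\lambda(X)$ for the set of real eigenvalues of $X \in \mathbb{R}^{p\times p}$. (i) For every $X \in \mathbb{R}^{p\times p}$, with $Y = X - \lambda I$: $\lambda \in \lambda(X)$ if and only if $\operatorname{rank}(Y) \le p-1$, and $\|A - BXC\| = \|\widetilde A - BYC\|$. (ii) Both of the following minima over $p \times p$ real matrices are attained, and $$\min_{\lambda \in \lambda(X)} \|A - BXC\| \;=\; \min_{\operatorname{rank}(Y)\le p-1} \|\widetilde A - BYC\|.$$ (iii) Closed form. Take singular value decompositions $B = U_B\Sigma_BV_B^{\mathsf T}$ and $C = U_C\Sigma_CV_C^{\mathsf T}$, with orthogonal $U_B, V_B, U_C, V_C$ and rectangular diagonal $\Sigma_B, \Sigma_C$ carrying the singular values in decreasing order. Let $s = \operatorname{rank} B$, $t = \operatorname{rank} C$, $S_B = \operatorname{diag}(\sigma_1(B),\dots,\sigma_s(B))$,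 $S_C = \operatorname{diag}(\sigma_1(C),\dots,\sigma_t(C))$. Let $\widetilde A_{11} \in \mathbb{R}^{s\times t}$ be the upper left block of $U_B^{\mathsf T}\widetilde A V_C$, let $\widetilde A_{11} = U\Sigma V^{\mathsf T}$ be a singular value decomposition, and for $r = p-1$ let $U_r\Sigma_rV_r^{\mathsf T}$ be its truncation to the $r$ largest singular values (all of $U\Sigma V^{\mathsf T}$ if $r \ge \min(s,t)$). Such decompositions exist, and for every choice of them the matrix $$Y = V_B\begin{bmatrix} S_B^{-1}U_r\Sigma_rV_r^{\mathsf T}S_C^{-1} & 0\\ 0 & 0\end{bmatrix}U_C^{\mathsf T}$$ attains the second minimum in (ii), and $X = Y + \lambda I$ attains the first. -/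

import Mathlib

-- The norm of a matrix is the Frobenius norm.
attribute [local instance] Matrix.frobeniusNormedAddCommGroup

/-- The `m × n` matrix with entries `σ 0, σ 1, …` on its main diagonal and zeros elsewhere. -/
def rectDiag (m n : ℕ) (σ : ℕ → ℝ) : Matrix (Fin m) (Fin n) ℝ :=
  Matrix.of fun i j => if (i : ℕ) = (j : ℕ) then σ i else 0

/-- `M = U Σ Vᵀ` is a (full) singular value decomposition: `U` and `V` are orthogonal, and `Σ` is
the rectangular diagonal matrix of the singular values `σ 0 ≥ σ 1 ≥ … ≥ 0`
(with `σ k = 0` for `k ≥ min m n` as a convention). -/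
structure IsSVD {m n : ℕ} (M : Matrix (Fin m) (Fin n) ℝ) (U : Matrix (Fin m) (Fin m) ℝ)
    (σ : ℕ → ℝ) (V : Matrix (Fin n) (Fin n) ℝ) : Prop where
  left_orthogonal : U ∈ Matrix.orthogonalGroup (Fin m) ℝ
  right_orthogonal : V ∈ Matrix.orthogonalGroup (Fin n) ℝ
  antitone : Antitone σ
  nonneg : ∀ k, 0 ≤ σ k
  eq_zero : ∀ k, min m n ≤ k → σ k = 0
  eq_mul : M = U * rectDiag m n σ * V.transpose

/-- The upper left `s × t` block of an `m × n` matrix. -/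
def topLeft {m n s t : ℕ} (hs : s ≤ m) (ht : t ≤ n) (M : Matrix (Fin m) (Fin n) ℝ) :
    Matrix (Fin s) (Fin t) ℝ :=
  M.submatrix (Fin.castLE hs) (Fin.castLE ht)

/-- The `p × q` block matrix `[M 0; 0 0]`, whose upper left block is `M`. -/
def padZero (p q : ℕ) {s t : ℕ} (M : Matrix (Fin s) (Fin t) ℝ) : Matrix (Fin p) (Fin q) ℝ :=
  Matrix.of fun i j =>
    if h : (i : ℕ) < s ∧ (j : ℕ) < t then M ⟨i, h.1⟩ ⟨j, h.2⟩ else 0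

/-- The truncation `U_r Σ_r V_rᵀ` of a singular value decomposition `U Σ Vᵀ` to its `r` leading
singular values (the whole of `U Σ Vᵀ` when `r` is at least the number of singular values). -/
def truncSVD {s t : ℕ} (r : ℕ) (U : Matrix (Fin s) (Fin s) ℝ) (σ : ℕ → ℝ)
    (V : Matrix (Fin t) (Fin t) ℝ) : Matrix (Fin s) (Fin t) ℝ :=
  U * rectDiag s t (fun k => if k < r then σ k else 0) * V.transpose

/-- `X` is an output of the generalized rank-constrained approximation algorithm on input
`A`, `B`, `C`, `r`: for some choice of singular value decompositions
`B = U_B Σ_B V_Bᵀ`, `C = U_C Σ_C V_Cᵀ` and `A₁₁ = U Σ Vᵀ`, where `A₁₁` is the upper left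
`rank B × rank C` block of `U_Bᵀ A V_C`, one has
`X = V_B [S_B⁻¹ U_r Σ_r V_rᵀ S_C⁻¹, 0; 0, 0] U_Cᵀ`, where `S_B` and `S_C` are the diagonal matrices
of the `rank B`, respectively `rank C`, leading singular values of `B` and `C`. -/
def IsRankApproxOutput {m n p q : ℕ} (A : Matrix (Fin m) (Fin n) ℝ) (B : Matrix (Fin m) (Fin p) ℝ)
    (C : Matrix (Fin q) (Fin n) ℝ) (r : ℕ) (X : Matrix (Fin p) (Fin q) ℝ) : Prop :=
  ∃ (UB : Matrix (Fin m) (Fin m) ℝ) (σB : ℕ → ℝ) (VB : Matrix (Fin p) (Fin p) ℝ)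
    (UC : Matrix (Fin q) (Fin q) ℝ) (σC : ℕ → ℝ) (VC : Matrix (Fin n) (Fin n) ℝ)
    (U : Matrix (Fin B.rank) (Fin B.rank) ℝ) (σ : ℕ → ℝ)
    (V : Matrix (Fin C.rank) (Fin C.rank) ℝ),
    IsSVD B UB σB VB ∧ IsSVD C UC σC VC ∧
    IsSVD (topLeft B.rank_le_height C.rank_le_width (UB.transpose * A * VC)) U σ V ∧
    X = VB *
      padZero p q
        ((Matrix.diagonal fun i : Fin B.rank => σB i)⁻¹ * truncSVD r U σ V *
          (Matrix.diagonal fun j : Fin C.rank => σC j)⁻¹) *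
      UC.transpose

/-! Since `B * X * C = B * Y * C + l • (B * C)` for `Y = X - l • 1`, the shift identifies the two
objectives. A square matrix has eigenvalue `l` exactly when its shift is singular, so it identifies
the constraints too (`mem_spectrum_iff_rank_le`). Only the rank-constrained problem remains.

There, orthogonal invariance of the Frobenius norm replaces `B` and `C` by their rectangular
diagonal factors, and `B * Y * C` becomes a matrix supported on the upper left `rank B × rank C`
block. Hence the squared objective is `‖A₁₁ - S_B Y₁₁ S_C‖ ^ 2` plus a constant independent of `Y`
(`norm_sub_mul_mul_sq`). For admissible `Y` the product `S_B Y₁₁ S_C` has rank at most `r`, so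
Eckart-Young bounds the objective below. Invertibility of `S_B` and `S_C` lets the output formula
make this product equal to the truncated SVD, which attains the bound.

Eckart-Young itself comes from an SVD of the competitor: at most `r` rows survive in its left
singular basis, and the remaining rows of the error carry a weighted sum of the `σ k ^ 2` with
weights in `[0, 1]` of fixed total (`sum_tail_le_sum_mul`). -/

theorem frobenius_norm_sq {m n : ℕ} (M : Matrix (Fin m) (Fin n) ℝ) :
    ‖M‖ ^ 2 = ∑ i, ∑ j, M i j ^ 2 := by
  have h : 0 ≤ ∑ i, ∑ j, M i j ^ 2 :=
    Finset.sum_nonneg fun i _ => Finset.sum_nonneg fun j _ => sq_nonneg _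
  rw [Matrix.frobenius_norm_def]
  simp only [Real.rpow_two, Real.norm_eq_abs, sq_abs]
  rw [← Real.sqrt_eq_rpow, Real.sq_sqrt h]

theorem frobenius_norm_sq_eq_trace {m n : ℕ} (M : Matrix (Fin m) (Fin n) ℝ) :
    ‖M‖ ^ 2 = (M * M.transpose).trace := by
  rw [frobenius_norm_sq]
  simp [Matrix.trace, Matrix.mul_apply, sq]

theorem transpose_mul_self_of_mem_orthogonalGroup {m : ℕ} {U : Matrix (Fin m) (Fin m) ℝ}
    (hU : U ∈ Matrix.orthogonalGroup (Fin m) ℝ) : U.transpose * U = 1 :=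
  (Matrix.mem_orthogonalGroup_iff' (Fin m) ℝ).1 hU

theorem mul_transpose_self_of_mem_orthogonalGroup {m : ℕ} {U : Matrix (Fin m) (Fin m) ℝ}
    (hU : U ∈ Matrix.orthogonalGroup (Fin m) ℝ) : U * U.transpose = 1 :=
  (Matrix.mem_orthogonalGroup_iff (Fin m) ℝ).1 hU

theorem transpose_mem_orthogonalGroup {m : ℕ} {U : Matrix (Fin m) (Fin m) ℝ}
    (hU : U ∈ Matrix.orthogonalGroup (Fin m) ℝ) :
    U.transpose ∈ Matrix.orthogonalGroup (Fin m) ℝ := by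
  rw [Matrix.mem_orthogonalGroup_iff]
  simpa [Matrix.star_eq_conjTranspose] using transpose_mul_self_of_mem_orthogonalGroup hU

theorem frobenius_norm_mul_orthogonal {m n : ℕ} (M : Matrix (Fin m) (Fin n) ℝ)
    {V : Matrix (Fin n) (Fin n) ℝ} (hV : V ∈ Matrix.orthogonalGroup (Fin n) ℝ) :
    ‖M * V‖ = ‖M‖ := by
  refine (sq_eq_sq₀ (norm_nonneg _) (norm_nonneg _)).1 ?_
  rw [frobenius_norm_sq_eq_trace, frobenius_norm_sq_eq_trace, Matrix.transpose_mul,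
    Matrix.mul_assoc, ← Matrix.mul_assoc V, mul_transpose_self_of_mem_orthogonalGroup hV,
    Matrix.one_mul]

theorem frobenius_norm_orthogonal_mul {m n : ℕ} (M : Matrix (Fin m) (Fin n) ℝ)
    {U : Matrix (Fin m) (Fin m) ℝ} (hU : U ∈ Matrix.orthogonalGroup (Fin m) ℝ) :
    ‖U * M‖ = ‖M‖ := by
  refine (sq_eq_sq₀ (norm_nonneg _) (norm_nonneg _)).1 ?_
  rw [frobenius_norm_sq_eq_trace, frobenius_norm_sq_eq_trace, Matrix.transpose_mul,
    Matrix.mul_assoc, Matrix.trace_mul_comm, Matrix.mul_assoc, Matrix.mul_assoc,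
    transpose_mul_self_of_mem_orthogonalGroup hU, Matrix.mul_one]

theorem rank_orthogonal_mul {m n : ℕ} (M : Matrix (Fin m) (Fin n) ℝ)
    {U : Matrix (Fin m) (Fin m) ℝ} (hU : U ∈ Matrix.orthogonalGroup (Fin m) ℝ) :
    (U * M).rank = M.rank := by
  refine le_antisymm (Matrix.rank_mul_le_right _ _) ?_
  have h := Matrix.rank_mul_le_right U.transpose (U * M)
  rwa [← Matrix.mul_assoc, transpose_mul_self_of_mem_orthogonalGroup hU, Matrix.one_mul] at h

theorem rank_mul_orthogonal {m n : ℕ} (M : Matrix (Fin m) (Fin n) ℝ)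
    {V : Matrix (Fin n) (Fin n) ℝ} (hV : V ∈ Matrix.orthogonalGroup (Fin n) ℝ) :
    (M * V).rank = M.rank := by
  refine le_antisymm (Matrix.rank_mul_le_left _ _) ?_
  have h := Matrix.rank_mul_le_left (M * V) V.transpose
  rwa [Matrix.mul_assoc, mul_transpose_self_of_mem_orthogonalGroup hV, Matrix.mul_one] at h

/-! ### Rectangular diagonal matrices and the rank read off from singular values. -/

theorem rectDiag_mul_apply {m p n : ℕ} (σ : ℕ → ℝ) (Z : Matrix (Fin p) (Fin n) ℝ)
    (i : Fin m) (j : Fin n) :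
    (rectDiag m p σ * Z) i j = if h : (i : ℕ) < p then σ i * Z ⟨i, h⟩ j else 0 := by
  rw [Matrix.mul_apply]
  split_ifs with h
  · rw [Finset.sum_eq_single ⟨i, h⟩]
    · simp [rectDiag]
    · intro k _ hk
      have : (i : ℕ) ≠ k := fun h' => hk (Fin.ext h'.symm)
      simp [rectDiag, this]
    · simp
  · refine Finset.sum_eq_zero fun k _ => ?_
    have : (i : ℕ) ≠ k := fun h' => h (h' ▸ k.2)
    simp [rectDiag, this]

theorem mul_rectDiag_apply {m q n : ℕ} (σ : ℕ → ℝ) (Z : Matrix (Fin m) (Fin q) ℝ)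
    (i : Fin m) (j : Fin n) :
    (Z * rectDiag q n σ) i j = if h : (j : ℕ) < q then Z i ⟨j, h⟩ * σ j else 0 := by
  rw [Matrix.mul_apply]
  split_ifs with h
  · rw [Finset.sum_eq_single ⟨j, h⟩]
    · simp [rectDiag]
    · intro k _ hk
      have : (k : ℕ) ≠ j := fun h' => hk (Fin.ext h')
      simp [rectDiag, this]
    · simp
  · refine Finset.sum_eq_zero fun k _ => ?_
    have : (k : ℕ) ≠ j := fun h' => h (h' ▸ k.2)
    simp [rectDiag, this]

theorem rectDiag_mul_transpose_self {m n : ℕ} {σ : ℕ → ℝ} (hσ : ∀ k, min m n ≤ k → σ k = 0) :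
    rectDiag m n σ * (rectDiag m n σ).transpose = Matrix.diagonal fun i : Fin m => σ i ^ 2 := by
  ext i j
  rw [rectDiag_mul_apply, Matrix.diagonal_apply]
  by_cases h : (i : ℕ) < n
  · rw [dif_pos h]
    by_cases hij : i = j
    · subst hij
      simp [rectDiag, sq]
    · have : (j : ℕ) ≠ i := fun h' => hij (Fin.ext h'.symm)
      simp [rectDiag, hij, this]
  · rw [dif_neg h, hσ i ((min_le_right _ _).trans (not_lt.1 h))]
    simp

theorem frobenius_norm_sq_rectDiag {m n : ℕ} {σ : ℕ → ℝ} (hσ : ∀ k, min m n ≤ k → σ k = 0) :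
    ‖rectDiag m n σ‖ ^ 2 = ∑ i : Fin m, σ i ^ 2 := by
  rw [frobenius_norm_sq_eq_trace, rectDiag_mul_transpose_self hσ, Matrix.trace_diagonal]

theorem rank_rectDiag {m n : ℕ} {σ : ℕ → ℝ} (hσ : ∀ k, min m n ≤ k → σ k = 0) :
    (rectDiag m n σ).rank = Fintype.card {i : Fin m // σ i ≠ 0} := by
  rw [← Matrix.rank_self_mul_transpose, rectDiag_mul_transpose_self hσ, Matrix.rank_diagonal]
  simp

theorem card_fin_ne_zero_le {m r : ℕ} {σ : ℕ → ℝ} (hσ : ∀ k, r ≤ k → σ k = 0) :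
    Fintype.card {i : Fin m // σ i ≠ 0} ≤ r := by
  have hlt : ∀ i : {i : Fin m // σ i ≠ 0}, (i.1 : ℕ) < r := fun i => by
    by_contra h
    exact i.2 (hσ _ (not_lt.1 h))
  simpa using Fintype.card_le_of_injective
    (fun i : {i : Fin m // σ i ≠ 0} => (⟨i.1, hlt i⟩ : Fin r))
    (fun a b h => Subtype.ext (Fin.ext (by simpa using h)))

theorem rank_rectDiag_le {m n r : ℕ} {σ : ℕ → ℝ} (hσ : ∀ k, min m n ≤ k → σ k = 0)
    (hr : ∀ k, r ≤ k → σ k = 0) : (rectDiag m n σ).rank ≤ r := by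
  rw [rank_rectDiag hσ]
  exact card_fin_ne_zero_le hr

theorem IsSVD.rank_eq {m n : ℕ} {M : Matrix (Fin m) (Fin n) ℝ} {U : Matrix (Fin m) (Fin m) ℝ}
    {σ : ℕ → ℝ} {V : Matrix (Fin n) (Fin n) ℝ} (h : IsSVD M U σ V) :
    M.rank = Fintype.card {i : Fin m // σ i ≠ 0} := by
  rw [h.eq_mul, rank_mul_orthogonal _ (transpose_mem_orthogonalGroup h.right_orthogonal),
    rank_orthogonal_mul _ h.left_orthogonal, rank_rectDiag h.eq_zero]

/-- A nonnegative decreasing sequence has an initial segment as support, and the length of that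
segment is the rank. -/
theorem IsSVD.ne_zero_iff {m n : ℕ} {M : Matrix (Fin m) (Fin n) ℝ}
    {U : Matrix (Fin m) (Fin m) ℝ} {σ : ℕ → ℝ} {V : Matrix (Fin n) (Fin n) ℝ}
    (h : IsSVD M U σ V) (k : ℕ) : σ k ≠ 0 ↔ k < M.rank := by
  rw [h.rank_eq]
  constructor
  · intro hk
    have hne : ∀ i, i ≤ k → σ i ≠ 0 := fun i hi =>
      ((lt_of_le_of_ne (h.nonneg k) hk.symm).trans_le (h.antitone hi)).ne'
    have hkm : k < m := by
      by_contra hkm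
      exact hk (h.eq_zero k ((min_le_left _ _).trans (not_lt.1 hkm)))
    have := Fintype.card_le_of_injective
      (fun i : Fin (k + 1) => (⟨⟨i, by omega⟩, hne i (by omega)⟩ : {i : Fin m // σ i ≠ 0}))
      (fun a b hab => Fin.ext (by simpa using hab))
    simpa [Nat.succ_le_iff] using this
  · intro hk h0
    refine absurd hk (not_lt.2 (card_fin_ne_zero_le fun i hi => ?_))
    exact le_antisymm ((h.antitone hi).trans h0.le) (h.nonneg i)

theorem IsSVD.eq_zero_of_rank_le {m n : ℕ} {M : Matrix (Fin m) (Fin n) ℝ}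
    {U : Matrix (Fin m) (Fin m) ℝ} {σ : ℕ → ℝ} {V : Matrix (Fin n) (Fin n) ℝ}
    (h : IsSVD M U σ V) {k : ℕ} (hk : M.rank ≤ k) : σ k = 0 := by
  by_contra h0
  exact absurd ((h.ne_zero_iff k).1 h0) (not_lt.2 hk)

/-! ### Existence of the singular value decomposition. -/

theorem orthonormalBasis_columns_mem_orthogonalGroup {m : ℕ}
    (u : OrthonormalBasis (Fin m) ℝ (EuclideanSpace ℝ (Fin m))) :
    (Matrix.of fun i j => u j i) ∈ Matrix.orthogonalGroup (Fin m) ℝ := by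
  rw [Matrix.mem_orthogonalGroup_iff']
  ext i j
  have := orthonormal_iff_ite.1 u.orthonormal i j
  rw [PiLp.inner_apply] at this
  simp only [Matrix.mul_apply, Matrix.of_apply, Matrix.one_apply]
  rw [← this]
  exact Finset.sum_congr rfl fun k _ => by simp [mul_comm]

/-- The right singular vectors are eigenvectors of `T* T`. Their images under `T` are orthogonal
with norms `σ i`; the nonzero ones, normalized, extend to an orthonormal basis of left singular
vectors. -/
theorem exists_isSVD {m n : ℕ} (M : Matrix (Fin m) (Fin n) ℝ) :
    ∃ U σ V, IsSVD M U σ V := by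
  set T : EuclideanSpace ℝ (Fin n) →ₗ[ℝ] EuclideanSpace ℝ (Fin m) :=
    Matrix.toEuclideanLin M with hT
  have hn : Module.finrank ℝ (EuclideanSpace ℝ (Fin n)) = n := finrank_euclideanSpace_fin
  have hm : Module.finrank ℝ (EuclideanSpace ℝ (Fin m)) = m := finrank_euclideanSpace_fin
  set v := T.isSymmetric_adjoint_comp_self.eigenvectorBasis hn with hv
  set σ : ℕ → ℝ := ⇑T.singularValues with hσ
  have hinner : ∀ i j, inner ℝ (T (v i)) (T (v j)) = if i = j then σ i ^ 2 else 0 := by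
    intro i j
    rw [← LinearMap.adjoint_inner_left]
    have h1 := T.isSymmetric_adjoint_comp_self.apply_eigenvectorBasis hn i
    rw [LinearMap.comp_apply] at h1
    rw [h1, ← T.sq_singularValues_fin hn i]
    rw [real_inner_smul_left, orthonormal_iff_ite.1 v.orthonormal i j]
    simp [hσ]
  have hσn : ∀ k, n ≤ k → σ k = 0 := fun k hk =>
    T.singularValues_of_finrank_le (hn.le.trans hk)
  have hσm : ∀ k, m ≤ k → σ k = 0 := fun k hk =>
    T.singularValues_eq_zero_iff_le_finrank_range.2
      (((Submodule.finrank_le _).trans hm.le).trans hk)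
  have hlt : ∀ k, σ k ≠ 0 → k < n := fun k hk => by
    by_contra h
    exact hk (hσn k (not_lt.1 h))
  let w : Fin m → EuclideanSpace ℝ (Fin m) := fun i =>
    if h : (i : ℕ) < n then (σ i)⁻¹ • T (v ⟨i, h⟩) else 0
  have hw : Orthonormal ℝ (({i : Fin m | σ i ≠ 0} : Set (Fin m)).domRestrict w) := by
    rw [orthonormal_iff_ite]
    rintro ⟨i, hi⟩ ⟨j, hj⟩
    have hi' : σ i ≠ 0 := hi
    have hj' : σ j ≠ 0 := hj
    simp only [Set.domRestrict_apply, w, dif_pos (hlt _ hi'), dif_pos (hlt _ hj')]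
    rw [real_inner_smul_left, real_inner_smul_right, hinner]
    by_cases hij : i = j
    · subst hij
      simp only [if_true]
      field_simp
    · have : (i : ℕ) ≠ j := fun h => hij (Fin.ext h)
      simp [hij, this]
  obtain ⟨u, hu⟩ := hw.exists_orthonormalBasis_extension_of_card_eq (by simp)
  have hV := orthonormalBasis_columns_mem_orthogonalGroup v
  refine ⟨Matrix.of fun i j => u j i, σ, Matrix.of fun i j => v j i,
    orthonormalBasis_columns_mem_orthogonalGroup u, hV,
    T.singularValues_antitone, T.singularValues_nonneg, ?_, ?_⟩
  · intro k hk
    rcases min_le_iff.1 hk with h | h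
    exacts [hσm k h, hσn k h]
  · have key : M * (Matrix.of fun i j => v j i) =
        (Matrix.of fun i j => u j i) * rectDiag m n σ := by
      ext i j
      rw [mul_rectDiag_apply]
      have h1 : (M * (Matrix.of fun i j => v j i)) i j = T (v j) i := by
        simp [hT, Matrix.mul_apply, Matrix.mulVec, dotProduct]
      rw [h1]
      -- When `σ j = 0` the image `T (v j)` vanishes, so the arbitrary completion of the basis is
      -- harmless.
      by_cases h0 : σ j = 0
      · have : T (v j) = 0 := by
          rw [← inner_self_eq_zero (𝕜 := ℝ), hinner]
          simp [h0]
        simp [this, h0]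
      · have hjm : (j : ℕ) < m := by
          by_contra h
          exact h0 (hσm j (not_lt.1 h))
        rw [dif_pos hjm, Matrix.of_apply, hu ⟨j, hjm⟩ h0]
        simp only [w, dif_pos j.2, Fin.eta, PiLp.smul_apply, smul_eq_mul]
        field_simp
    rw [← key, Matrix.mul_assoc, mul_transpose_self_of_mem_orthogonalGroup hV, Matrix.mul_one]

/-! ### Eckart-Young for the Frobenius norm. -/

theorem sum_tail_le_sum_mul {s r : ℕ} {a : ℕ → ℝ} (ha : Antitone a) {c : Fin s → ℝ}
    (h0 : ∀ j, 0 ≤ c j) (h1 : ∀ j, c j ≤ 1)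
    (hc : ∑ j, c j = ∑ j : Fin s, if (j : ℕ) < r then (0 : ℝ) else 1) :
    (∑ j : Fin s, if (j : ℕ) < r then 0 else a j) ≤ ∑ j : Fin s, a j * c j := by
  -- With threshold `a r`, the two factors are both nonnegative for `j < r` and both nonpositive
  -- afterwards. Equality of the totals cancels the `a r` contribution.
  have h : 0 ≤ ∑ j : Fin s, (a j - a r) * (c j - if (j : ℕ) < r then (0 : ℝ) else 1) := by
    refine Finset.sum_nonneg fun j _ => ?_
    split_ifs with hj
    · exact mul_nonneg (sub_nonneg.2 (ha hj.le)) (by simpa using h0 j)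
    · exact mul_nonneg_of_nonpos_of_nonpos (sub_nonpos.2 (ha (not_lt.1 hj)))
        (sub_nonpos.2 (h1 j))
  have e : ∑ j : Fin s, (a j - a r) * (c j - if (j : ℕ) < r then (0 : ℝ) else 1) =
      ∑ j : Fin s, a j * c j - (∑ j : Fin s, if (j : ℕ) < r then 0 else a j) -
        a r * (∑ j, c j - ∑ j : Fin s, if (j : ℕ) < r then (0 : ℝ) else 1) := by
    rw [mul_sub, Finset.mul_sum, Finset.mul_sum, ← Finset.sum_sub_distrib,
      ← Finset.sum_sub_distrib, ← Finset.sum_sub_distrib]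
    refine Finset.sum_congr rfl fun j _ => ?_
    split_ifs <;> ring
  rw [e, hc] at h
  linarith

/-- The lower bound in the Eckart-Young theorem for the Frobenius norm. -/
theorem IsSVD.sum_tail_sq_le {s t r : ℕ} {M : Matrix (Fin s) (Fin t) ℝ}
    {U : Matrix (Fin s) (Fin s) ℝ} {σ : ℕ → ℝ} {V : Matrix (Fin t) (Fin t) ℝ}
    (h : IsSVD M U σ V) {N : Matrix (Fin s) (Fin t) ℝ} (hN : N.rank ≤ r) :
    (∑ k : Fin s, if (k : ℕ) < r then 0 else σ k ^ 2) ≤ ‖M - N‖ ^ 2 := by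
  have hU := h.left_orthogonal
  have hV := h.right_orthogonal
  set D := rectDiag s t σ with hD
  obtain ⟨P, τ, Q, hPQ⟩ := exists_isSVD (U.transpose * N * V)
  have hP := hPQ.left_orthogonal
  have hτ : ∀ k, r ≤ k → τ k = 0 := fun k hk => hPQ.eq_zero_of_rank_le <| by
    rw [rank_mul_orthogonal _ hV, rank_orthogonal_mul _ (transpose_mem_orthogonalGroup hU)]
    exact hN.trans hk
  have hnorm : ‖M - N‖ = ‖P.transpose * D - rectDiag s t τ * Q.transpose‖ := by
    have h1 : U.transpose * (M - N) * V = D - P * rectDiag s t τ * Q.transpose := by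
      rw [← hPQ.eq_mul, Matrix.mul_sub, Matrix.sub_mul]
      nth_rw 1 [h.eq_mul]
      congr 1
      calc U.transpose * (U * D * V.transpose) * V
          = (U.transpose * U) * D * (V.transpose * V) := by simp only [Matrix.mul_assoc]
        _ = D := by
          rw [transpose_mul_self_of_mem_orthogonalGroup hU,
            transpose_mul_self_of_mem_orthogonalGroup hV, Matrix.one_mul, Matrix.mul_one]
    have h2 : P.transpose * (D - P * rectDiag s t τ * Q.transpose) =
        P.transpose * D - rectDiag s t τ * Q.transpose := by
      rw [Matrix.mul_sub, Matrix.mul_assoc, ← Matrix.mul_assoc P.transpose P,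
        transpose_mul_self_of_mem_orthogonalGroup hP, Matrix.one_mul]
    rw [← h2, frobenius_norm_orthogonal_mul _ (transpose_mem_orthogonalGroup hP), ← h1,
      frobenius_norm_mul_orthogonal _ hV,
      frobenius_norm_orthogonal_mul _ (transpose_mem_orthogonalGroup hU)]
  have hrow : ∀ i, ∑ j, (P.transpose * D) i j ^ 2 = ∑ k : Fin s, σ k ^ 2 * P k i ^ 2 := by
    intro i
    have h1 : (P.transpose * D) * (P.transpose * D).transpose =
        P.transpose * (Matrix.diagonal fun k : Fin s => σ k ^ 2) * P := by
      rw [← rectDiag_mul_transpose_self h.eq_zero, Matrix.transpose_mul,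
        Matrix.transpose_transpose]
      simp only [Matrix.mul_assoc, hD]
    have h2 := congrFun (congrFun h1 i) i
    rw [Matrix.mul_apply, Matrix.mul_apply] at h2
    simp only [Matrix.transpose_apply (P.transpose * D), Matrix.mul_diagonal] at h2
    calc _ = ∑ j, (P.transpose * D) i j * (P.transpose * D) i j := by simp only [sq]
      _ = _ := h2
      _ = _ := Finset.sum_congr rfl fun k _ => by rw [Matrix.transpose_apply]; ring
  have hPcol : ∀ i, ∑ k, P k i ^ 2 = 1 := fun i => by
    have := congrFun (congrFun (transpose_mul_self_of_mem_orthogonalGroup hP) i) i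
    simpa [Matrix.mul_apply, sq] using this
  have hProw : ∀ k, ∑ i, P k i ^ 2 = 1 := fun k => by
    have := congrFun (congrFun (mul_transpose_self_of_mem_orthogonalGroup hP) k) k
    simpa [Matrix.mul_apply, sq] using this
  -- Indicator of the rows on which `rectDiag s t τ * Q.transpose` vanishes; the other rows of the
  -- error are discarded.
  let e : Fin s → ℝ := fun i => if (i : ℕ) < r then 0 else 1
  have he0 : ∀ i, 0 ≤ e i := fun i => by simp only [e]; split_ifs <;> norm_num
  have he1 : ∀ i, e i ≤ 1 := fun i => by simp only [e]; split_ifs <;> norm_num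
  have hsq : Antitone fun k => σ k ^ 2 := fun i j hij =>
    pow_le_pow_left₀ (h.nonneg j) (h.antitone hij) 2
  calc (∑ k : Fin s, if (k : ℕ) < r then 0 else σ k ^ 2)
      ≤ ∑ k : Fin s, σ k ^ 2 * ∑ i, e i * P k i ^ 2 := by
        -- The weight of `σ k ^ 2` is the part of row `k` of `P` in the columns `i ≥ r`: at most 1
        -- because rows of `P` are unit vectors, with the right total because columns are.
        refine sum_tail_le_sum_mul (r := r) hsq
          (fun k => Finset.sum_nonneg fun i _ => mul_nonneg (he0 i) (sq_nonneg _))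
          (fun k => ?_) ?_
        · rw [← hProw k]
          exact Finset.sum_le_sum fun i _ => mul_le_of_le_one_left (sq_nonneg _) (he1 i)
        · rw [Finset.sum_comm]
          exact Finset.sum_congr rfl fun i _ => by rw [← Finset.mul_sum, hPcol, mul_one]
    _ = ∑ i, e i * ∑ j, (P.transpose * D) i j ^ 2 := by
        simp only [hrow, Finset.mul_sum]
        rw [Finset.sum_comm]
        exact Finset.sum_congr rfl fun i _ => Finset.sum_congr rfl fun k _ => by ring
    _ ≤ ∑ i, ∑ j, (P.transpose * D - rectDiag s t τ * Q.transpose) i j ^ 2 := by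
        refine Finset.sum_le_sum fun i _ => ?_
        by_cases hi : (i : ℕ) < r
        · simp only [e, if_pos hi, zero_mul]
          exact Finset.sum_nonneg fun j _ => sq_nonneg _
        · simp only [e, if_neg hi, one_mul]
          refine Finset.sum_le_sum fun j _ => le_of_eq ?_
          rw [Matrix.sub_apply, rectDiag_mul_apply, hτ i (not_lt.1 hi)]
          simp
    _ = ‖M - N‖ ^ 2 := by rw [hnorm, frobenius_norm_sq]

theorem IsSVD.rank_truncSVD_le {s t : ℕ} {M : Matrix (Fin s) (Fin t) ℝ}
    {U : Matrix (Fin s) (Fin s) ℝ} {σ : ℕ → ℝ} {V : Matrix (Fin t) (Fin t) ℝ}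
    (h : IsSVD M U σ V) (r : ℕ) : (truncSVD r U σ V).rank ≤ r := by
  refine (Matrix.rank_mul_le_left _ _).trans ((Matrix.rank_mul_le_right _ _).trans ?_)
  refine rank_rectDiag_le (fun k hk => ?_) fun k hk => if_neg (not_lt.2 hk)
  simp [h.eq_zero k hk]

theorem IsSVD.norm_sub_truncSVD_sq {s t : ℕ} {M : Matrix (Fin s) (Fin t) ℝ}
    {U : Matrix (Fin s) (Fin s) ℝ} {σ : ℕ → ℝ} {V : Matrix (Fin t) (Fin t) ℝ}
    (h : IsSVD M U σ V) (r : ℕ) :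
    ‖M - truncSVD r U σ V‖ ^ 2 = ∑ k : Fin s, if (k : ℕ) < r then 0 else σ k ^ 2 := by
  have h1 : M - truncSVD r U σ V =
      U * rectDiag s t (fun k => if k < r then 0 else σ k) * V.transpose := by
    rw [truncSVD]
    nth_rw 1 [h.eq_mul]
    rw [← Matrix.sub_mul, ← Matrix.mul_sub]
    congr 2
    ext i j
    simp only [rectDiag, Matrix.sub_apply, Matrix.of_apply]
    split_ifs <;> simp
  rw [h1, frobenius_norm_mul_orthogonal _ (transpose_mem_orthogonalGroup h.right_orthogonal),
    frobenius_norm_orthogonal_mul _ h.left_orthogonal, frobenius_norm_sq_rectDiag]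
  · exact Finset.sum_congr rfl fun k _ => by split_ifs <;> simp
  · intro k hk
    simp [h.eq_zero k hk]

/-- The Eckart-Young theorem for the Frobenius norm. -/
theorem IsSVD.norm_sub_truncSVD_sq_le {s t r : ℕ} {M : Matrix (Fin s) (Fin t) ℝ}
    {U : Matrix (Fin s) (Fin s) ℝ} {σ : ℕ → ℝ} {V : Matrix (Fin t) (Fin t) ℝ}
    (h : IsSVD M U σ V) {N : Matrix (Fin s) (Fin t) ℝ} (hN : N.rank ≤ r) :
    ‖M - truncSVD r U σ V‖ ^ 2 ≤ ‖M - N‖ ^ 2 :=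
  (h.norm_sub_truncSVD_sq r).le.trans (h.sum_tail_sq_le hN)

/-! ### Reduction to the upper left block. -/

theorem frobenius_norm_sub_padZero_sq {m n s t : ℕ} (hs : s ≤ m) (ht : t ≤ n)
    (M : Matrix (Fin m) (Fin n) ℝ) (W : Matrix (Fin s) (Fin t) ℝ) :
    ‖M - padZero m n W‖ ^ 2 =
      ‖topLeft hs ht M - W‖ ^ 2 + (‖M‖ ^ 2 - ‖topLeft hs ht M‖ ^ 2) := by
  -- Subtracting the squared entries of `M` makes the summand vanish off the block.
  have key : ∑ x : Fin s × Fin t,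
        ((topLeft hs ht M - W) x.1 x.2 ^ 2 - topLeft hs ht M x.1 x.2 ^ 2) =
      ∑ x : Fin m × Fin n, ((M - padZero m n W) x.1 x.2 ^ 2 - M x.1 x.2 ^ 2) := by
    refine Fintype.sum_of_injective (Prod.map (Fin.castLE hs) (Fin.castLE ht))
      ((Fin.castLE_injective hs).prodMap (Fin.castLE_injective ht)) _ _ ?_ ?_
    · rintro ⟨i, j⟩ hij
      have : ¬ ((i : ℕ) < s ∧ (j : ℕ) < t) := fun h =>
        hij ⟨(⟨i, h.1⟩, ⟨j, h.2⟩), rfl⟩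
      simp [padZero, this]
    · rintro ⟨i, j⟩
      simp [padZero, topLeft]
  simp only [Finset.sum_sub_distrib, Fintype.sum_prod_type, ← frobenius_norm_sq] at key
  linarith

theorem rank_padZero_le {p q s t : ℕ} (M : Matrix (Fin s) (Fin t) ℝ) :
    (padZero p q M).rank ≤ M.rank := by
  have : padZero p q M = rectDiag p s (fun _ => 1) * M * rectDiag t q (fun _ => 1) := by
    ext i j
    rw [mul_rectDiag_apply]
    by_cases hj : (j : ℕ) < t
    · rw [dif_pos hj, rectDiag_mul_apply]
      by_cases hi : (i : ℕ) < s <;> simp [padZero, hi, hj]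
    · simp [padZero, hj]
  rw [this]
  exact (Matrix.rank_mul_le_left _ _).trans (Matrix.rank_mul_le_right _ _)

theorem topLeft_padZero {p q s t : ℕ} (hs : s ≤ p) (ht : t ≤ q) (M : Matrix (Fin s) (Fin t) ℝ) :
    topLeft hs ht (padZero p q M) = M := by
  ext i j
  simp [topLeft, padZero]

theorem rectDiag_mul_mul_rectDiag {m n p q s t : ℕ} (hs : s ≤ p) (ht : t ≤ q) {σ τ : ℕ → ℝ}
    (hσ : ∀ k, s ≤ k → σ k = 0) (hτ : ∀ k, t ≤ k → τ k = 0) (Z : Matrix (Fin p) (Fin q) ℝ) :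
    rectDiag m p σ * Z * rectDiag q n τ =
      padZero m n ((Matrix.diagonal fun i : Fin s => σ i) * topLeft hs ht Z *
        Matrix.diagonal fun j : Fin t => τ j) := by
  ext i j
  rw [mul_rectDiag_apply]
  simp only [rectDiag_mul_apply, padZero, Matrix.of_apply, Matrix.mul_diagonal,
    Matrix.diagonal_mul, topLeft, Matrix.submatrix_apply]
  by_cases hi : (i : ℕ) < s
  · by_cases hj : (j : ℕ) < t
    · simp [hi, hj, hi.trans_le hs, hj.trans_le ht]
    · simp [hj, hτ j (not_lt.1 hj)]
  · simp [hi, hσ i (not_lt.1 hi)]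

theorem norm_sub_mul_mul_sq {m n p q : ℕ} (A : Matrix (Fin m) (Fin n) ℝ)
    {B : Matrix (Fin m) (Fin p) ℝ} {C : Matrix (Fin q) (Fin n) ℝ}
    {UB : Matrix (Fin m) (Fin m) ℝ} {σB : ℕ → ℝ} {VB : Matrix (Fin p) (Fin p) ℝ}
    {UC : Matrix (Fin q) (Fin q) ℝ} {σC : ℕ → ℝ} {VC : Matrix (Fin n) (Fin n) ℝ}
    (hB : IsSVD B UB σB VB) (hC : IsSVD C UC σC VC) (Y : Matrix (Fin p) (Fin q) ℝ) :
    ‖A - B * Y * C‖ ^ 2 =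
      ‖topLeft B.rank_le_height C.rank_le_width (UB.transpose * A * VC) -
        (Matrix.diagonal fun i : Fin B.rank => σB i) *
          topLeft B.rank_le_width C.rank_le_height (VB.transpose * Y * UC) *
          (Matrix.diagonal fun j : Fin C.rank => σC j)‖ ^ 2 +
      (‖A‖ ^ 2 -
        ‖topLeft B.rank_le_height C.rank_le_width (UB.transpose * A * VC)‖ ^ 2) := by
  have h1 : UB.transpose * (A - B * Y * C) * VC = UB.transpose * A * VC -
      rectDiag m p σB * (VB.transpose * Y * UC) * rectDiag q n σC := by
    rw [Matrix.mul_sub, Matrix.sub_mul]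
    congr 1
    calc UB.transpose * (B * Y * C) * VC
        = UB.transpose * ((UB * rectDiag m p σB * VB.transpose) * Y *
            (UC * rectDiag q n σC * VC.transpose)) * VC := by
          rw [← hB.eq_mul, ← hC.eq_mul]
      _ = (UB.transpose * UB) * (rectDiag m p σB * (VB.transpose * Y * UC) * rectDiag q n σC) *
            (VC.transpose * VC) := by simp only [Matrix.mul_assoc]
      _ = _ := by
          rw [transpose_mul_self_of_mem_orthogonalGroup hB.left_orthogonal,
            transpose_mul_self_of_mem_orthogonalGroup hC.right_orthogonal, Matrix.one_mul,
            Matrix.mul_one]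
  have h2 : ∀ M : Matrix (Fin m) (Fin n) ℝ, ‖UB.transpose * M * VC‖ = ‖M‖ := fun M => by
    rw [frobenius_norm_mul_orthogonal _ hC.right_orthogonal,
      frobenius_norm_orthogonal_mul _ (transpose_mem_orthogonalGroup hB.left_orthogonal)]
  rw [← h2 (A - B * Y * C), h1, rectDiag_mul_mul_rectDiag B.rank_le_width C.rank_le_height
    (fun k => hB.eq_zero_of_rank_le) (fun k => hC.eq_zero_of_rank_le),
    frobenius_norm_sub_padZero_sq B.rank_le_height C.rank_le_width, h2 A]

/-- Makes the `⁻¹` in the output formula a genuine inverse; on a singular matrix it would be the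
default value 0. -/
theorem IsSVD.isUnit_diagonal {m n : ℕ} {M : Matrix (Fin m) (Fin n) ℝ}
    {U : Matrix (Fin m) (Fin m) ℝ} {σ : ℕ → ℝ} {V : Matrix (Fin n) (Fin n) ℝ}
    (h : IsSVD M U σ V) : IsUnit (Matrix.diagonal fun i : Fin M.rank => σ i).det := by
  rw [Matrix.det_diagonal, isUnit_iff_ne_zero, Finset.prod_ne_zero_iff]
  exact fun i _ => (h.ne_zero_iff i).2 i.2

/-! ### Optimality of the rank-constrained algorithm. -/

theorem exists_isRankApproxOutput {m n p q : ℕ} (A : Matrix (Fin m) (Fin n) ℝ)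
    (B : Matrix (Fin m) (Fin p) ℝ) (C : Matrix (Fin q) (Fin n) ℝ) (r : ℕ) :
    ∃ Y, IsRankApproxOutput A B C r Y := by
  obtain ⟨UB, σB, VB, hB⟩ := exists_isSVD B
  obtain ⟨UC, σC, VC, hC⟩ := exists_isSVD C
  obtain ⟨U, σ, V, h⟩ := exists_isSVD
    (topLeft B.rank_le_height C.rank_le_width (UB.transpose * A * VC))
  exact ⟨_, UB, σB, VB, UC, σC, VC, U, σ, V, hB, hC, h, rfl⟩

theorem IsRankApproxOutput.rank_le {m n p q r : ℕ} {A : Matrix (Fin m) (Fin n) ℝ}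
    {B : Matrix (Fin m) (Fin p) ℝ} {C : Matrix (Fin q) (Fin n) ℝ}
    {Y : Matrix (Fin p) (Fin q) ℝ} (hY : IsRankApproxOutput A B C r Y) : Y.rank ≤ r := by
  obtain ⟨UB, σB, VB, UC, σC, VC, U, σ, V, -, -, h, rfl⟩ := hY
  refine (Matrix.rank_mul_le_left _ _).trans ((Matrix.rank_mul_le_right _ _).trans ?_)
  refine (rank_padZero_le _).trans ((Matrix.rank_mul_le_left _ _).trans ?_)
  exact (Matrix.rank_mul_le_right _ _).trans (h.rank_truncSVD_le r)

theorem IsRankApproxOutput.norm_le {m n p q r : ℕ} {A : Matrix (Fin m) (Fin n) ℝ}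
    {B : Matrix (Fin m) (Fin p) ℝ} {C : Matrix (Fin q) (Fin n) ℝ}
    {Y : Matrix (Fin p) (Fin q) ℝ} (hY : IsRankApproxOutput A B C r Y)
    {Z : Matrix (Fin p) (Fin q) ℝ} (hZ : Z.rank ≤ r) :
    ‖A - B * Y * C‖ ≤ ‖A - B * Z * C‖ := by
  obtain ⟨UB, σB, VB, UC, σC, VC, U, σ, V, hB, hC, h, rfl⟩ := hY
  refine (sq_le_sq₀ (norm_nonneg _) (norm_nonneg _)).1 ?_
  rw [norm_sub_mul_mul_sq A hB hC, norm_sub_mul_mul_sq A hB hC]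
  refine add_le_add ?_ le_rfl
  set SB := Matrix.diagonal fun i : Fin B.rank => σB i with hSB
  set SC := Matrix.diagonal fun j : Fin C.rank => σC j with hSC
  have e1 : ∀ W : Matrix (Fin p) (Fin q) ℝ,
      VB.transpose * (VB * W * UC.transpose) * UC = W := fun W => by
    calc VB.transpose * (VB * W * UC.transpose) * UC
        = (VB.transpose * VB) * W * (UC.transpose * UC) := by simp only [Matrix.mul_assoc]
      _ = W := by
        rw [transpose_mul_self_of_mem_orthogonalGroup hB.right_orthogonal,
          transpose_mul_self_of_mem_orthogonalGroup hC.left_orthogonal, Matrix.one_mul,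
          Matrix.mul_one]
  have e2 : SB * (SB⁻¹ * truncSVD r U σ V * SC⁻¹) * SC = truncSVD r U σ V := by
    calc SB * (SB⁻¹ * truncSVD r U σ V * SC⁻¹) * SC
        = (SB * SB⁻¹) * truncSVD r U σ V * (SC⁻¹ * SC) := by simp only [Matrix.mul_assoc]
      _ = truncSVD r U σ V := by
        rw [Matrix.mul_nonsing_inv _ hB.isUnit_diagonal, Matrix.nonsing_inv_mul _
          hC.isUnit_diagonal, Matrix.one_mul, Matrix.mul_one]
  rw [e1, topLeft_padZero, e2]
  refine h.norm_sub_truncSVD_sq_le ?_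
  -- Multiplying and passing to a block never raise the rank, so the competitor `Z` yields an
  -- admissible Eckart-Young competitor.
  refine (Matrix.rank_mul_le_left _ _).trans ((Matrix.rank_mul_le_right _ _).trans ?_)
  refine (Matrix.rank_submatrix_le _ _ _).trans ?_
  exact (Matrix.rank_mul_le_left _ _).trans ((Matrix.rank_mul_le_right _ _).trans hZ)

/-! ### Eigenvalues as a rank condition, and the main theorem. -/

theorem mem_spectrum_iff_rank_le {p : ℕ} (hp : 1 ≤ p) (X : Matrix (Fin p) (Fin p) ℝ) (l : ℝ) :
    l ∈ spectrum ℝ X ↔ (X - l • (1 : Matrix (Fin p) (Fin p) ℝ)).rank ≤ p - 1 := by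
  have h1 : l ∈ spectrum ℝ X ↔ ¬ IsUnit (X - l • (1 : Matrix (Fin p) (Fin p) ℝ)) := by
    rw [spectrum.mem_iff, Algebra.algebraMap_eq_smul_one, ← IsUnit.neg_iff, neg_sub]
  rw [h1]
  have h2 := (X - l • (1 : Matrix (Fin p) (Fin p) ℝ)).rank_le_width
  constructor
  · intro h
    by_contra h3
    have h4 : (X - l • (1 : Matrix (Fin p) (Fin p) ℝ)).rank = p := by omega
    refine h ?_
    rw [← Matrix.linearIndependent_cols_iff_isUnit, linearIndependent_iff_card_eq_finrank_span,
      Set.finrank, ← Matrix.rank_eq_finrank_span_cols, h4, Fintype.card_fin]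
  · intro h h3
    rw [Matrix.rank_of_isUnit _ h3, Fintype.card_fin] at h
    -- Here `1 ≤ p` matters: for `p = 0` the truncated `p - 1` equals `p`, and a unit would satisfy
    -- the rank bound.
    omega

theorem mainTheorem7 (n p : ℕ) (hp : 1 ≤ p) (A : Matrix (Fin n) (Fin n) ℝ)
    (B : Matrix (Fin n) (Fin p) ℝ) (C : Matrix (Fin p) (Fin n) ℝ) (l : ℝ) :
    -- `Y = X - l I` carries one problem to the other, constraint and objective
    (∀ X : Matrix (Fin p) (Fin p) ℝ,
      (l ∈ spectrum ℝ X ↔ (X - l • (1 : Matrix (Fin p) (Fin p) ℝ)).rank ≤ p - 1) ∧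
      ‖A - B * X * C‖ =
        ‖(A - l • (B * C)) - B * (X - l • (1 : Matrix (Fin p) (Fin p) ℝ)) * C‖) ∧
    -- both minima are attained, and they are equal
    (∃ μ : ℝ,
      IsLeast ((fun X : Matrix (Fin p) (Fin p) ℝ => ‖A - B * X * C‖) ''
        {X | l ∈ spectrum ℝ X}) μ ∧
      IsLeast ((fun Y : Matrix (Fin p) (Fin p) ℝ => ‖(A - l • (B * C)) - B * Y * C‖) ''
        {Y | Y.rank ≤ p - 1}) μ) ∧
    -- the rank-constrained algorithm on input `A - l B C`, `B`, `C`, `p - 1` has an output, and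
    -- every output `Y` solves the second problem, with `X = Y + l I` solving the first
    (∃ Y, IsRankApproxOutput (A - l • (B * C)) B C (p - 1) Y) ∧
    (∀ Y, IsRankApproxOutput (A - l • (B * C)) B C (p - 1) Y →
      (Y.rank ≤ p - 1 ∧
        IsMinOn (fun Y : Matrix (Fin p) (Fin p) ℝ => ‖(A - l • (B * C)) - B * Y * C‖)
          {Y | Y.rank ≤ p - 1} Y) ∧
      (l ∈ spectrum ℝ (Y + l • (1 : Matrix (Fin p) (Fin p) ℝ)) ∧
        IsMinOn (fun X : Matrix (Fin p) (Fin p) ℝ => ‖A - B * X * C‖)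
          {X | l ∈ spectrum ℝ X} (Y + l • (1 : Matrix (Fin p) (Fin p) ℝ)))) := by
  have hspec := fun X => mem_spectrum_iff_rank_le hp X l
  have hnorm : ∀ X : Matrix (Fin p) (Fin p) ℝ, ‖A - B * X * C‖ =
      ‖(A - l • (B * C)) - B * (X - l • (1 : Matrix (Fin p) (Fin p) ℝ)) * C‖ := fun X => by
    congr 1
    simp [Matrix.mul_sub, Matrix.sub_mul]
  have hout : ∀ Y, IsRankApproxOutput (A - l • (B * C)) B C (p - 1) Y →
      (Y.rank ≤ p - 1 ∧
        IsMinOn (fun Y : Matrix (Fin p) (Fin p) ℝ => ‖(A - l • (B * C)) - B * Y * C‖)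
          {Y | Y.rank ≤ p - 1} Y) ∧
      (l ∈ spectrum ℝ (Y + l • (1 : Matrix (Fin p) (Fin p) ℝ)) ∧
        IsMinOn (fun X : Matrix (Fin p) (Fin p) ℝ => ‖A - B * X * C‖)
          {X | l ∈ spectrum ℝ X} (Y + l • (1 : Matrix (Fin p) (Fin p) ℝ))) := by
    intro Y hY
    refine ⟨⟨hY.rank_le, isMinOn_iff.2 fun Z hZ => hY.norm_le hZ⟩, ?_,
      isMinOn_iff.2 fun X hX => ?_⟩
    · rw [hspec, add_sub_cancel_right]
      exact hY.rank_le
    · rw [hnorm, hnorm X, add_sub_cancel_right]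
      exact hY.norm_le ((hspec X).1 hX)
  obtain ⟨Y, hY⟩ := exists_isRankApproxOutput (A - l • (B * C)) B C (p - 1)
  obtain ⟨⟨hr, hmin⟩, hs, hmin'⟩ := hout Y hY
  refine ⟨fun X => ⟨hspec X, hnorm X⟩, ⟨‖(A - l • (B * C)) - B * Y * C‖, ⟨⟨_, hs, ?_⟩, ?_⟩,
    ⟨Y, hr, rfl⟩, ?_⟩, ⟨Y, hY⟩, hout⟩
  · simp only [hnorm, add_sub_cancel_right]
  · rintro _ ⟨X, hX, rfl⟩
    simp only [hnorm X]
    exact hY.norm_le ((hspec X).1 hX)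
  · rintro _ ⟨Z, hZ, rfl⟩
    exact hY.norm_le hZ
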